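/- Fix $n\ge 1$ and consider real polynomials in the variables $x_1,\dots,x_n,\bar x_1,\dots,\bar x_n$. Let $B_n$ be the set of Boolean axioms $x_i^2-x_i$, $\bar x_i^2-\bar x_i$, $x_i+\bar x_i-1$ for $i\in[n]=\{1,\dots,n\}$. For an integer $k$, a Sums-of-Squares (SOS) refutation of the Knapsack equation $\mathrm{KS}_{n,k}$: $2x_1+\cdots+2x_n=k$ is a polynomial identity $$-1=\sum_{i=1}^{m} r_i^2+t\cdot(2x_1+\cdots+2x_n-k)+\sum_{q\in B_n}u_q\,q ,$$ where $m\ge 0$ and the $r_i$, $t$ and $u_q$ are arbitrary polynomials. Its monomial size is $\sum_{i=1}^m \mathrm{size}(r_i)+\mathrm{size}(t)$, where $\mathrm{size}(f)$ is the number of monomials with non-zero coefficient in $f$; the polynomials $u_q$ are not counted. **Corollary (Knapsack lower bound).** There exists a real $\varepsilon>0$ such that for every sufficiently large natural number $n$ and every $k\in[n]$, every SOS refutation of $\mathrm{KS}_{n,k}$ has monomial size at least $2^{\varepsilon k^2/n}$. -/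

import Mathlib

namespace SOSKnapsack

/-- Polynomials with real coefficients in `n` pairs of twin variables: `Sum.inl i` indexes the
basic variable `x i`, and `Sum.inr i` its twin. -/
abbrev TwinPoly (n : ℕ) : Type := MvPolynomial (Fin n ⊕ Fin n) ℝ

/-- The number of terms of a polynomial. -/
def size {n : ℕ} (f : TwinPoly n) : ℕ := f.support.card

/-- The Boolean axiom `z ^ 2 - z` for a variable `z`, basic or twin. -/
noncomputable def boolAxiom {n : ℕ} (z : Fin n ⊕ Fin n) : TwinPoly n :=
  MvPolynomial.X z ^ 2 - MvPolynomial.X z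

/-- The Boolean axiom stating that a basic variable and its twin add up to `1`. -/
noncomputable def twinAxiom {n : ℕ} (i : Fin n) : TwinPoly n :=
  MvPolynomial.X (Sum.inl i) + MvPolynomial.X (Sum.inr i) - 1

/-- The sum of the squares of the polynomials in a list. -/
noncomputable def sumSq {n : ℕ} (rs : List (TwinPoly n)) : TwinPoly n :=
  (rs.map fun r => r ^ 2).sum

/-- An explicit Sums-of-Squares proof of `target ≥ 0` from the inequality constraints `q j ≥ 0`
and the equality constraints `p j = 0`, over the Boolean axioms. The sum-of-squares multipliers
are given by the lists of the polynomials that are squared. -/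
structure SOSProof {n l m : ℕ} (q : Fin l → TwinPoly n) (p : Fin m → TwinPoly n)
    (target : TwinPoly n) where
  /-- the polynomials whose squares add up to the free sum of squares -/
  r₀ : List (TwinPoly n)
  /-- the polynomials whose squares add up to the multiplier of `q j` -/
  r : Fin l → List (TwinPoly n)
  /-- the multipliers of the equality constraints -/
  t : Fin m → TwinPoly n
  /-- the multipliers of the Boolean axioms `z ^ 2 - z` -/
  u : Fin n ⊕ Fin n → TwinPoly n
  /-- the multipliers of the Boolean axioms for pairs of twin variables -/
  v : Fin n → TwinPoly n
  identity : target = sumSq r₀ + ∑ j, sumSq (r j) * q j + ∑ j, t j * p j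
    + (∑ z, u z * boolAxiom z + ∑ i, v i * twinAxiom i)

/-- The monomial size of a proof: multipliers of the Boolean axioms are not counted. -/
def SOSProof.monomialSize {n l m : ℕ} {q : Fin l → TwinPoly n} {p : Fin m → TwinPoly n}
    {target : TwinPoly n} (π : SOSProof q p target) : ℕ :=
  (π.r₀.map size).sum + ∑ j, ((π.r j).map size).sum + ∑ j, size (π.t j)

/-- A refutation is a proof of `-1 ≥ 0`. -/
abbrev SOSRefutation {n l m : ℕ} (q : Fin l → TwinPoly n) (p : Fin m → TwinPoly n) : Type :=
  SOSProof q p (-1)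

/-- The polynomial `2 x₁ + ⋯ + 2 xₙ - k` of the Knapsack equation `2 x₁ + ⋯ + 2 xₙ = k`. -/
noncomputable def knapsackPoly (n k : ℕ) : TwinPoly n :=
  ∑ i : Fin n, 2 * MvPolynomial.X (Sum.inl i) - (k : TwinPoly n)

/-- SOS refutations of the system whose only constraint is the Knapsack equation
`2 x₁ + ⋯ + 2 xₙ = k`: there are no inequality constraints. -/
abbrev KnapsackRefutation (n k : ℕ) : Type :=
  SOSRefutation (Fin.elim0 : Fin 0 → TwinPoly n) (fun _ : Fin 1 => knapsackPoly n k)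

end SOSKnapsack

/-! A small refutation can be restricted to one of low degree, and a pseudoexpectation rules that
out.

If the size is below `(n / (n - m)) ^ m`, a greedy averaging argument (`exists_hitting_set`) finds
at most `m` variables to set to `0` and at most `m` to set to `1` so that every monomial not killed
has at most `3 * m` variables. By `exists_restrict`, what remains refutes `∑ x = κ` in degree `3 *
m` on the set `V` of free variables, where `κ` is `k / 2` minus the number of ones set.

The uniform distribution on points with `κ` ones has moments that make sense for every real `κ`. The
resulting functional respects the constraint (`pseudoExp_mul_sum`) and is nonnegative on squares of
low degree (`pseudoExp_sq_nonneg`). For the latter, the constraint makes every function homogeneous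
of degree `D`, and the Gram matrix of the degree-`D` monomials is a nonnegative combination of
rank-one matrices `[A ⊆ S] [A ⊆ T]`.

With `m` about `k / 32`, `(1 - m / n) ^ (-m) ≥ exp (m ^ 2 / n)` gives the bound. -/

namespace SOSKnapsack

open Finset

/-! ### Pseudoprobabilities -/

/-- The falling factorial `x (x - 1) ⋯ (x - s + 1)`. -/
noncomputable def fallingFactorial (x : ℝ) (s : ℕ) : ℝ := ∏ i ∈ range s, (x - i)

lemma fallingFactorial_succ (x : ℝ) (s : ℕ) :
    fallingFactorial x (s + 1) = fallingFactorial x s * (x - s) := prod_range_succ _ _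

lemma fallingFactorial_nonneg {x : ℝ} {s : ℕ} (h : (s : ℝ) ≤ x) : 0 ≤ fallingFactorial x s := by
  refine prod_nonneg fun i hi => ?_
  have : (i : ℝ) ≤ s := by exact_mod_cast (mem_range.1 hi).le
  linarith

lemma fallingFactorial_natCast_pos {N s : ℕ} (h : s ≤ N) : 0 < fallingFactorial N s := by
  refine prod_pos fun i hi => ?_
  have : (i : ℝ) < N := by exact_mod_cast (mem_range.1 hi).trans_le h
  linarith

/-- The pseudoprobability that, among `N` Boolean variables summing to `κ`, `a` given variables
are `1` and `b` other given variables are `0`. -/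
noncomputable def pseudoProb (N : ℕ) (κ : ℝ) (a b : ℕ) : ℝ :=
  fallingFactorial κ a * fallingFactorial (N - κ) b / fallingFactorial N (a + b)

lemma pseudoProb_nonneg {N : ℕ} {κ : ℝ} {a b : ℕ} (ha : (a : ℝ) ≤ κ) (hb : (b : ℝ) ≤ N - κ)
    (hab : a + b ≤ N) : 0 ≤ pseudoProb N κ a b :=
  div_nonneg (mul_nonneg (fallingFactorial_nonneg ha) (fallingFactorial_nonneg hb))
    (fallingFactorial_natCast_pos hab).le

/-- One more variable is summed out: `(κ - a) + (N - κ - b) = N - (a + b)`. -/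
lemma pseudoProb_split {N : ℕ} (κ : ℝ) {a b : ℕ} (h : a + b < N) :
    pseudoProb N κ (a + 1) b + pseudoProb N κ a (b + 1) = pseudoProb N κ a b := by
  have h1 := (fallingFactorial_natCast_pos h.le).ne'
  have h2 : (N : ℝ) - (a + b : ℕ) ≠ 0 := by
    have : ((a + b : ℕ) : ℝ) < N := by exact_mod_cast h
    linarith
  unfold pseudoProb
  rw [show a + 1 + b = a + b + 1 by ring, ← add_assoc a b 1]
  simp only [fallingFactorial_succ]
  field_simp
  push_cast
  ring

lemma pseudoProb_succ_left {N : ℕ} (κ : ℝ) {a : ℕ} (h : a < N) :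
    (N - a) * pseudoProb N κ (a + 1) 0 = (κ - a) * pseudoProb N κ a 0 := by
  have h1 := (fallingFactorial_natCast_pos h.le).ne'
  have h2 : (N : ℝ) - a ≠ 0 := by
    have : (a : ℝ) < N := by exact_mod_cast h
    linarith
  unfold pseudoProb
  simp only [add_zero, fallingFactorial_succ]
  field_simp

variable {α : Type*} [DecidableEq α]

lemma sum_powerset_pseudoProb {N : ℕ} (κ : ℝ) (I : Finset α) (a b : ℕ) (h : a + b + #I ≤ N) :
    ∑ J ∈ I.powerset, pseudoProb N κ (a + #(I \ J)) (b + #J) = pseudoProb N κ a b := by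
  induction I using Finset.induction_on generalizing a b with
  | empty => simp
  | insert j I hj ih =>
    rw [card_insert_of_notMem hj] at h
    rw [sum_powerset_insert hj, ← pseudoProb_split κ (by omega), ← ih (a + 1) b (by omega),
      ← ih a (b + 1) (by omega)]
    congr 1
    · refine sum_congr rfl fun J hJ => ?_
      have hjJ : j ∉ J := fun h => hj (mem_powerset.1 hJ h)
      rw [insert_sdiff_of_notMem _ hjJ, card_insert_of_notMem (by simp [hj])]
      congr 1
      ring
    · refine sum_congr rfl fun J hJ => ?_
      have hjJ : j ∉ J := fun h => hj (mem_powerset.1 hJ h)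
      rw [card_insert_of_notMem hjJ, insert_sdiff_insert, sdiff_insert_of_notMem hj]
      congr 1
      ring

/-! ### The pseudoexpectation and the Knapsack constraint -/

/-- The pseudoexpectation of a function on the Boolean cube of subsets of `V`. -/
noncomputable def pseudoExp (V : Finset α) (κ : ℝ) : (Finset α → ℝ) →ₗ[ℝ] ℝ :=
  ∑ X ∈ V.powerset, pseudoProb #V κ #X #(V \ X) • LinearMap.proj X

lemma pseudoExp_apply (V : Finset α) (κ : ℝ) (f : Finset α → ℝ) :
    pseudoExp V κ f = ∑ X ∈ V.powerset, pseudoProb #V κ #X #(V \ X) * f X := by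
  simp [pseudoExp]

lemma pseudoExp_congr {V : Finset α} (κ : ℝ) {f g : Finset α → ℝ} (h : ∀ X ⊆ V, f X = g X) :
    pseudoExp V κ f = pseudoExp V κ g := by
  simp only [pseudoExp_apply]
  exact sum_congr rfl fun X hX => by rw [h X (mem_powerset.1 hX)]

/-- The monomial `∏ i ∈ S, x i` as a function on the Boolean cube. -/
def ind (S : Finset α) (X : Finset α) : ℝ := if S ⊆ X then 1 else 0

lemma ind_mul_ind (S T : Finset α) : ind S * ind T = ind (S ∪ T) := by
  ext X
  simp only [Pi.mul_apply, ind, union_subset_iff]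
  split_ifs <;> simp_all

lemma ind_empty : ind (∅ : Finset α) = 1 := by
  ext X
  simp [ind]

lemma pseudoExp_ind {V S : Finset α} (κ : ℝ) (hS : S ⊆ V) :
    pseudoExp V κ (ind S) = pseudoProb #V κ #S 0 := by
  have hcard : #S + #(V \ S) = #V := by rw [add_comm]; exact card_sdiff_add_card_eq_card hS
  rw [pseudoExp_apply, ← sum_powerset_pseudoProb κ (V \ S) #S 0 (by omega)]
  simp only [ind, mul_ite, mul_one, mul_zero]
  rw [← sum_filter]
  refine sum_nbij' (fun X => V \ X) (fun J => V \ J) ?_ ?_ ?_ ?_ ?_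
  · intro X hX
    simp only [mem_filter, mem_powerset] at hX ⊢
    exact sdiff_subset_sdiff subset_rfl hX.2
  · intro J hJ
    simp only [mem_filter, mem_powerset] at hJ ⊢
    refine ⟨sdiff_subset, fun x hx => mem_sdiff.2 ⟨hS hx, fun h => ?_⟩⟩
    exact (mem_sdiff.1 (hJ h)).2 hx
  · intro X hX
    simp only [mem_filter, mem_powerset] at hX
    exact Finset.sdiff_sdiff_eq_self hX.1
  · intro J hJ
    simp only [mem_powerset] at hJ
    exact Finset.sdiff_sdiff_eq_self (hJ.trans sdiff_subset)
  · intro X hX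
    simp only [mem_filter, mem_powerset] at hX
    congr 1
    · rw [← card_union_of_disjoint]
      · congr 1
        ext x
        have := @hX.1 x
        have := @hX.2 x
        simp only [mem_union, mem_sdiff]
        tauto
      · exact disjoint_left.2 fun x hx h => (mem_sdiff.1 (mem_sdiff.1 h).1).2 hx
    · simp

/-- The Boolean functions of the variables in `V` of degree at most `e`. -/
def degLE (V : Finset α) (e : ℕ) : Submodule ℝ (Finset α → ℝ) :=
  Submodule.span ℝ (ind '' {S | S ⊆ V ∧ #S ≤ e})

/-- The combinations of multilinear monomials of degree exactly `e` in the variables in `V`. -/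
def degEq (V : Finset α) (e : ℕ) : Submodule ℝ (Finset α → ℝ) :=
  Submodule.span ℝ (ind '' {S | S ⊆ V ∧ #S = e})

lemma ind_mem_degLE {V S : Finset α} {e : ℕ} (hS : S ⊆ V) (he : #S ≤ e) : ind S ∈ degLE V e :=
  Submodule.subset_span ⟨S, ⟨hS, he⟩, rfl⟩

lemma degEq_le_degLE (V : Finset α) (e : ℕ) : degEq V e ≤ degLE V e :=
  Submodule.span_mono (Set.image_mono fun _ hS => ⟨hS.1, hS.2.le⟩)

lemma degLE_mono (V : Finset α) {e e' : ℕ} (h : e ≤ e') : degLE V e ≤ degLE V e' :=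
  Submodule.span_mono (Set.image_mono fun _ hS => ⟨hS.1, hS.2.trans h⟩)

lemma mul_ind_singleton_mem_degLE {V : Finset α} {e : ℕ} {f : Finset α → ℝ} (hf : f ∈ degLE V e)
    {j : α} (hj : j ∈ V) : f * ind {j} ∈ degLE V (e + 1) := by
  have : degLE V e ≤ (degLE V (e + 1)).comap (LinearMap.mulRight ℝ (ind {j})) := by
    refine Submodule.span_le.2 ?_
    rintro _ ⟨S, ⟨hS, hSe⟩, rfl⟩
    change ind S * ind {j} ∈ degLE V (e + 1)
    rw [ind_mul_ind]
    refine ind_mem_degLE (union_subset hS (by simpa using hj)) ((card_union_le _ _).trans ?_)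
    simpa using hSe
  exact this hf

/-- The constraint `∑ i, x i = κ` holds for the pseudoexpectation, against a monomial. -/
lemma pseudoExp_ind_mul_sum {V S : Finset α} (κ : ℝ) (hS : S ⊆ V) (h : #S < #V) :
    pseudoExp V κ (ind S * ∑ j ∈ V, ind {j}) = κ * pseudoExp V κ (ind S) := by
  have hsum : pseudoExp V κ (ind S * ∑ j ∈ V, ind {j})
      = ∑ j ∈ V, pseudoProb #V κ #(insert j S) 0 := by
    rw [mul_sum, map_sum]
    refine sum_congr rfl fun j hj => ?_
    rw [ind_mul_ind, union_comm, ← insert_eq, pseudoExp_ind κ (insert_subset hj hS)]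
  rw [hsum, pseudoExp_ind κ hS, ← sum_sdiff hS,
    sum_congr rfl (g := fun _ => pseudoProb #V κ (#S + 1) 0)
      fun j hj => by rw [card_insert_of_notMem (mem_sdiff.1 hj).2],
    sum_congr (s₁ := S) rfl (g := fun _ => pseudoProb #V κ #S 0)
      fun j hj => by rw [insert_eq_of_mem hj]]
  simp only [sum_const, nsmul_eq_mul]
  rw [card_sdiff_of_subset hS, Nat.cast_sub h.le, pseudoProb_succ_left κ h]
  ring

lemma pseudoExp_mul_sum {V : Finset α} (κ : ℝ) {e : ℕ} (he : e < #V) {f : Finset α → ℝ}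
    (hf : f ∈ degLE V e) :
    pseudoExp V κ (f * ∑ j ∈ V, ind {j}) = κ * pseudoExp V κ f := by
  have : degLE V e ≤ LinearMap.eqLocus
      ((pseudoExp V κ).comp (LinearMap.mulRight ℝ (∑ j ∈ V, ind {j}))) (κ • pseudoExp V κ) := by
    refine Submodule.span_le.2 ?_
    rintro _ ⟨S, ⟨hS, hSe⟩, rfl⟩
    exact pseudoExp_ind_mul_sum κ hS (hSe.trans_lt he)
  exact this hf

lemma ind_mul_sum_singleton {V S : Finset α} (hS : S ⊆ V) :
    ind S * ∑ j ∈ V, ind {j} = (#S : ℝ) • ind S + ∑ j ∈ V \ S, ind (insert j S) := by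
  rw [mul_sum, ← sum_sdiff hS, add_comm]
  congr 1
  · rw [sum_congr rfl (g := fun _ => ind S) fun j hj => by
      rw [ind_mul_ind, union_eq_left.2 (singleton_subset_iff.2 hj)]]
    rw [sum_const, Nat.cast_smul_eq_nsmul]
  · exact sum_congr rfl fun j hj => by rw [ind_mul_ind, union_comm, ← insert_eq]

/-! ### Positivity on squares of low degree -/

/-- Modulo the constraint `∑ i, x i = κ`, a monomial is homogeneous of degree `D`. -/
lemma exists_homogeneous_ind {V : Finset α} {κ : ℝ} {D : ℕ} (hκ : (D : ℝ) ≤ κ)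
    (hV : 2 * D < #V) (r : ℕ) : ∀ S ⊆ V, #S + r = D →
    ∃ g ∈ degEq V D, ∀ h ∈ degLE V D,
      pseudoExp V κ (ind S * h) = pseudoExp V κ (g * h) := by
  induction r with
  | zero => exact fun S hS hr => ⟨ind S, Submodule.subset_span ⟨S, ⟨hS, hr⟩, rfl⟩, fun _ _ => rfl⟩
  | succ r ih =>
    intro S hS hr
    -- The constraint times `ind S` reads `(κ - #S) * ind S = ∑ j ∉ S, ind (insert j S)`, so
    -- dividing by `κ - #S` raises the degree by one.
    have hne : κ - #S ≠ 0 := by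
      have : ((#S : ℕ) : ℝ) < D := by exact_mod_cast (by omega : #S < D)
      linarith
    have key : ∀ j ∈ V \ S, ∃ g ∈ degEq V D, ∀ h ∈ degLE V D,
        pseudoExp V κ (ind (insert j S) * h) = pseudoExp V κ (g * h) := fun j hj =>
      ih _ (insert_subset (mem_sdiff.1 hj).1 hS)
        (by rw [card_insert_of_notMem (mem_sdiff.1 hj).2]; omega)
    choose! g hg hgE using key
    refine ⟨(κ - #S)⁻¹ • ∑ j ∈ V \ S, g j, Submodule.smul_mem _ _ (Submodule.sum_mem _ hg),
      fun h hh => ?_⟩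
    rw [smul_mul_assoc, map_smul, sum_mul, map_sum, smul_eq_mul, eq_inv_mul_iff_mul_eq₀ hne,
      ← sum_congr rfl fun j hj => hgE j hj h hh, ← map_sum, ← sum_mul]
    have hmem : ind S * h ∈ degLE V (2 * D) := by
      have : degLE V D ≤ (degLE V (2 * D)).comap (LinearMap.mulLeft ℝ (ind S)) := by
        refine Submodule.span_le.2 ?_
        rintro _ ⟨T, ⟨hT, hTD⟩, rfl⟩
        change ind S * ind T ∈ degLE V (2 * D)
        rw [ind_mul_ind]
        exact ind_mem_degLE (union_subset hS hT) ((card_union_le _ _).trans (by omega))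
      exact this hh
    have h1 := pseudoExp_mul_sum κ hV hmem
    rw [mul_right_comm, ind_mul_sum_singleton hS, add_mul, map_add, smul_mul_assoc, map_smul,
      smul_eq_mul] at h1
    linarith

lemma exists_homogeneous {V : Finset α} {κ : ℝ} {D : ℕ} (hκ : (D : ℝ) ≤ κ)
    (hV : 2 * D < #V) {f : Finset α → ℝ} (hf : f ∈ degLE V D) :
    ∃ g ∈ degEq V D, ∀ h ∈ degLE V D,
      pseudoExp V κ (f * h) = pseudoExp V κ (g * h) := by
  induction hf using Submodule.span_induction with
  | mem f hf =>
    obtain ⟨S, ⟨hS, hSD⟩, rfl⟩ := hf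
    exact exists_homogeneous_ind hκ hV (D - #S) S hS (by omega)
  | zero => exact ⟨0, Submodule.zero_mem _, fun _ _ => rfl⟩
  | add f₁ f₂ _ _ h₁ h₂ =>
    obtain ⟨g₁, hg₁, H₁⟩ := h₁
    obtain ⟨g₂, hg₂, H₂⟩ := h₂
    refine ⟨g₁ + g₂, Submodule.add_mem _ hg₁ hg₂, fun h hh => ?_⟩
    rw [add_mul, add_mul, map_add, map_add, H₁ h hh, H₂ h hh]
  | smul c f _ h₁ =>
    obtain ⟨g, hg, H⟩ := h₁
    refine ⟨c • g, Submodule.smul_mem _ _ hg, fun h hh => ?_⟩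
    rw [smul_mul_assoc, smul_mul_assoc, map_smul, map_smul, H h hh]

lemma exists_coeff_of_mem_degEq {V : Finset α} {D : ℕ} {f : Finset α → ℝ} (hf : f ∈ degEq V D) :
    ∃ c : Finset α → ℝ, f = ∑ S ∈ V.powersetCard D, c S • ind S := by
  have hset : ({S | S ⊆ V ∧ #S = D} : Set (Finset α)) = ↑(V.powersetCard D) := by
    ext S
    simp [mem_powersetCard]
  rw [degEq, hset, Submodule.mem_span_image_finset_iff_exists_fun] at hf
  obtain ⟨c, rfl⟩ := hf
  refine ⟨fun S => if h : S ∈ V.powersetCard D then c ⟨S, h⟩ else 0, ?_⟩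
  rw [← sum_coe_sort (V.powersetCard D)]
  exact sum_congr rfl fun S _ => by simp only [S.2, dite_true]

/-- The moment depends only on `#(S ∪ T)`. Splitting it over `#(S ∩ T)` fresh variables, with `A`
marking the zeros, makes the weights depend on `#A` alone, since `#(S ∪ T) + #(S ∩ T) = 2 * D`. -/
lemma pseudoExp_ind_mul_ind {V S T : Finset α} (κ : ℝ) {D : ℕ} (hV : 2 * D ≤ #V)
    (hS : S ∈ V.powersetCard D) (hT : T ∈ V.powersetCard D) :
    pseudoExp V κ (ind S * ind T)
      = ∑ A ∈ V.powerset, if A ⊆ S ∧ A ⊆ T then pseudoProb #V κ (2 * D - #A) #A else 0 := by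
  rw [mem_powersetCard] at hS hT
  have hc := card_union_add_card_inter S T
  rw [ind_mul_ind, pseudoExp_ind κ (union_subset hS.1 hT.1),
    ← sum_powerset_pseudoProb κ (S ∩ T) _ 0 (by omega), ← sum_filter]
  refine sum_congr ?_ fun A hA => ?_
  · ext A
    simp only [mem_powerset, mem_filter, subset_inter_iff]
    exact ⟨fun h => ⟨h.1.trans hS.1, h⟩, fun h => h.2⟩
  · have hA : A ⊆ S ∩ T := by
      simp only [mem_filter] at hA
      exact subset_inter hA.2.1 hA.2.2
    have := card_le_card hA
    rw [card_sdiff_of_subset hA, zero_add]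
    congr 1
    omega

lemma pseudoExp_sq_nonneg_of_mem_degEq {V : Finset α} {κ : ℝ} {D : ℕ} (hκ : 2 * (D : ℝ) ≤ κ)
    (hκ' : (D : ℝ) ≤ #V - κ) (hV : 2 * D ≤ #V) {f : Finset α → ℝ} (hf : f ∈ degEq V D) :
    0 ≤ pseudoExp V κ (f * f) := by
  obtain ⟨c, rfl⟩ := exists_coeff_of_mem_degEq hf
  have hexp : pseudoExp V κ ((∑ S ∈ V.powersetCard D, c S • ind S) *
      ∑ S ∈ V.powersetCard D, c S • ind S)
      = ∑ A ∈ V.powerset, pseudoProb #V κ (2 * D - #A) #A *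
        (∑ S ∈ V.powersetCard D, if A ⊆ S then c S else 0) ^ 2 := by
    rw [sum_mul_sum, map_sum]
    have hR : ∀ A ∈ V.powerset, pseudoProb #V κ (2 * D - #A) #A *
        (∑ S ∈ V.powersetCard D, if A ⊆ S then c S else 0) ^ 2
        = ∑ S ∈ V.powersetCard D, ∑ T ∈ V.powersetCard D, pseudoProb #V κ (2 * D - #A) #A *
          ((if A ⊆ S then c S else 0) * if A ⊆ T then c T else 0) := fun A _ => by
      rw [sq, sum_mul_sum, mul_sum]
      exact sum_congr rfl fun S _ => mul_sum _ _ _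
    rw [sum_congr rfl hR, sum_comm]
    refine sum_congr rfl fun S hS => ?_
    rw [map_sum, sum_comm]
    refine sum_congr rfl fun T hT => ?_
    rw [smul_mul_smul_comm, map_smul, smul_eq_mul, pseudoExp_ind_mul_ind κ hV hS hT, mul_sum]
    refine sum_congr rfl fun A _ => ?_
    split_ifs <;> simp_all [mul_comm]
  rw [hexp]
  refine sum_nonneg fun A _ => ?_
  -- Larger `A` lie in no `S` of size `D`, so their squares vanish.
  by_cases hA : #A ≤ D
  · refine mul_nonneg (pseudoProb_nonneg ?_ ?_ (by omega)) (sq_nonneg _)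
    · refine le_trans ?_ hκ
      exact_mod_cast Nat.sub_le _ _
    · refine le_trans ?_ hκ'
      exact_mod_cast hA
  · rw [sum_eq_zero fun S hS => if_neg fun h => hA ?_]
    · simp
    · exact (card_le_card h).trans (mem_powersetCard.1 hS).2.le

/-- Positivity of the pseudoexpectation on squares of functions of low degree. -/
lemma pseudoExp_sq_nonneg {V : Finset α} {κ : ℝ} {D : ℕ} (hκ : 2 * (D : ℝ) ≤ κ)
    (hκ' : (D : ℝ) ≤ #V - κ) (hV : 2 * D < #V) {f : Finset α → ℝ} (hf : f ∈ degLE V D) :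
    0 ≤ pseudoExp V κ (f * f) := by
  obtain ⟨g, hg, H⟩ := exists_homogeneous (κ := κ)
    (by linarith [(Nat.cast_nonneg D : (0 : ℝ) ≤ D)]) hV hf
  rw [H f hf, mul_comm, H g (degEq_le_degLE V D hg)]
  exact pseudoExp_sq_nonneg_of_mem_degEq hκ hκ' hV.le hg

lemma pseudoExp_one (V : Finset α) (κ : ℝ) : pseudoExp V κ 1 = 1 := by
  rw [← ind_empty, pseudoExp_ind κ (empty_subset V)]
  simp [pseudoProb, fallingFactorial]

/-- The degree lower bound for the Knapsack equation. -/
lemma no_low_degree_refutation {V : Finset α} {κ : ℝ} {D : ℕ} (hκ : 2 * (D : ℝ) ≤ κ)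
    (hκ' : (D : ℝ) ≤ #V - κ) (hV : 2 * D < #V) {rs : List (Finset α → ℝ)} {t : Finset α → ℝ}
    (hrs : ∀ r ∈ rs, r ∈ degLE V D) (ht : t ∈ degLE V D)
    (h : ∀ X ⊆ V, -1 = (rs.map fun r => r X ^ 2).sum + t X * (#X - κ)) : False := by
  have hnn : 0 ≤ pseudoExp V κ (rs.map fun r => r * r).sum := by
    rw [map_list_sum, List.map_map]
    refine List.sum_nonneg fun y hy => ?_
    obtain ⟨r, hr, rfl⟩ := List.mem_map.1 hy
    exact pseudoExp_sq_nonneg hκ hκ' hV (hrs r hr)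
  have h0 := pseudoExp_mul_sum κ (by omega) ht
  have h1 : pseudoExp V κ (-1)
      = pseudoExp V κ ((rs.map fun r => r * r).sum + (t * ∑ j ∈ V, ind {j} - κ • t)) := by
    refine pseudoExp_congr κ fun X hX => ?_
    have hc : (∑ j ∈ V, ind {j}) X = (#X : ℝ) := by
      simp only [Finset.sum_apply, ind, singleton_subset_iff, sum_boole]
      rw [filter_mem_eq_inter, inter_eq_right.2 hX]
    have hl : ((rs.map fun r => r * r).sum) X = (rs.map fun r => r X ^ 2).sum := by
      clear hrs h hnn
      induction rs with
      | nil => rfl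
      | cons r rs ih => simp [sq, ih]
    simp only [Pi.add_apply, Pi.sub_apply, Pi.mul_apply, Pi.smul_apply, Pi.neg_apply,
      Pi.one_apply, smul_eq_mul, hc, hl]
    rw [h X hX]
    ring
  rw [map_neg, pseudoExp_one, map_add, map_sub, h0, map_smul, smul_eq_mul] at h1
  linarith

/-! ### Hitting sets and restrictions -/

/-- Greedy hitting sets for families of large sets. -/
lemma exists_hitting_set {ι : Type*} [Fintype α] (A : ι → Finset α) {d : ℕ}
    (hd : d ≤ Fintype.card α) (M : Finset ι) (hM : ∀ i ∈ M, d ≤ #(A i)) (m : ℕ) :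
    ∃ Z : Finset α, #Z ≤ m ∧
      #{i ∈ M | Disjoint (A i) Z} * Fintype.card α ^ m ≤ #M * (Fintype.card α - d) ^ m := by
  classical
  induction m with
  | zero => exact ⟨∅, by simp⟩
  | succ m ih =>
    obtain ⟨Z, hZ, h⟩ := ih
    set M' := {i ∈ M | Disjoint (A i) Z} with hM'
    rcases isEmpty_or_nonempty α with hα | hα
    · exact ⟨∅, by simp⟩
    -- On average over `u`, a fraction at least `d / card α` of the surviving sets contains `u`.
    obtain ⟨u, -, hu⟩ : ∃ u ∈ (univ : Finset α),
        d * #M' ≤ Fintype.card α * #{i ∈ M' | u ∈ A i} := by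
      refine exists_le_of_sum_le univ_nonempty ?_
      rw [sum_const, ← mul_sum, card_univ, smul_eq_mul]
      refine Nat.mul_le_mul_left _ ?_
      have hdc := sum_card_bipartiteAbove_eq_sum_card_bipartiteBelow (s := univ) (t := M')
        fun u i => u ∈ A i
      simp only [bipartiteAbove] at hdc
      rw [hdc, mul_comm, ← smul_eq_mul]
      refine card_nsmul_le_sum _ _ _ fun i hi => ?_
      simpa [bipartiteBelow] using hM i (mem_filter.1 hi).1
    refine ⟨insert u Z, (card_insert_le _ _).trans (by omega), ?_⟩
    have hsplit := card_filter_add_card_filter_not (s := M') fun i => u ∈ A i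
    have hsub : #{i ∈ M | Disjoint (A i) (insert u Z)} ≤ #{i ∈ M' | u ∉ A i} := by
      refine card_le_card fun i hi => ?_
      simp only [hM', mem_filter, disjoint_insert_right] at hi ⊢
      exact ⟨⟨hi.1, hi.2.2⟩, hi.2.1⟩
    have hstep : #{i ∈ M' | u ∉ A i} * Fintype.card α ≤ #M' * (Fintype.card α - d) := by
      zify [hd] at hu hsplit ⊢
      nlinarith
    calc _ ≤ #{i ∈ M' | u ∉ A i} * Fintype.card α ^ (m + 1) := by gcongr
      _ = #{i ∈ M' | u ∉ A i} * Fintype.card α * Fintype.card α ^ m := by ring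
      _ ≤ #M' * (Fintype.card α - d) * Fintype.card α ^ m := by gcongr
      _ = #M' * Fintype.card α ^ m * (Fintype.card α - d) := by ring
      _ ≤ #M * (Fintype.card α - d) ^ m * (Fintype.card α - d) := by gcongr
      _ = _ := by ring

/-- The Boolean assignment of the twin variables that is given by the set of true variables. -/
def point {n : ℕ} (X : Finset (Fin n)) : Fin n ⊕ Fin n → ℝ :=
  Sum.elim (fun i => if i ∈ X then 1 else 0) fun i => if i ∈ X then 0 else 1

/-- The indices of the basic variables of a monomial. -/
def posVars {n : ℕ} (σ : Fin n ⊕ Fin n →₀ ℕ) : Finset (Fin n) := {i | σ (Sum.inl i) ≠ 0}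

/-- The indices of the twin variables of a monomial. -/
def negVars {n : ℕ} (σ : Fin n ⊕ Fin n →₀ ℕ) : Finset (Fin n) := {i | σ (Sum.inr i) ≠ 0}

lemma prod_point_pow {n : ℕ} (X : Finset (Fin n)) (σ : Fin n ⊕ Fin n →₀ ℕ) :
    (∏ z, point X z ^ σ z) = ind (posVars σ) X * ∏ i ∈ negVars σ, (1 - ind {i} X) := by
  rw [Fintype.prod_sum_type]
  congr 1
  · simp only [point, Sum.elim_inl, ind]
    split_ifs with h
    · refine prod_eq_one fun i _ => ?_
      by_cases hi : i ∈ X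
      · simp [hi]
      · have : i ∉ posVars σ := fun hh => hi (h hh)
        simp only [posVars, mem_filter, mem_univ, true_and, not_not] at this
        simp [this]
    · obtain ⟨i, hi, hiX⟩ := not_subset.1 h
      refine prod_eq_zero (mem_univ i) ?_
      simp only [posVars, mem_filter, mem_univ, true_and] at hi
      simp [hiX, hi]
  · rw [← prod_subset (subset_univ (negVars σ))]
    · refine prod_congr rfl fun i hi => ?_
      simp only [negVars, mem_filter, mem_univ, true_and] at hi
      by_cases hX : i ∈ X <;> simp [point, ind, hX, hi]
    · intro i _ hi
      simp only [negVars, mem_filter, mem_univ, true_and, not_not] at hi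
      simp [hi]

lemma mul_prod_one_sub_mem_degLE {V : Finset α} {e : ℕ} {f : Finset α → ℝ} (hf : f ∈ degLE V e)
    (B : Finset α) (hB : B ⊆ V) : (f * ∏ i ∈ B, (1 - ind {i})) ∈ degLE V (e + #B) := by
  induction B using Finset.induction_on with
  | empty => simpa using hf
  | insert j B hj ih =>
    have ih := ih ((subset_insert _ _).trans hB)
    rw [prod_insert hj, card_insert_of_notMem hj, mul_left_comm, sub_mul, one_mul,
      mul_comm (ind _), ← add_assoc]
    exact Submodule.sub_mem _ (degLE_mono V (Nat.le_succ _) ih)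
      (mul_ind_singleton_mem_degLE ih (hB (mem_insert_self _ _)))

/-- Under a restriction that sets the variables in `O` to `1` and those in `Z` to `0`, a monomial
is either killed or has no more variables than before. -/
lemma exists_restrict_monomial {n : ℕ} {O Z : Finset (Fin n)} (hOZ : Disjoint O Z)
    (σ : Fin n ⊕ Fin n →₀ ℕ) {D : ℕ}
    (h : Disjoint (posVars σ) Z → Disjoint (negVars σ) O → #(posVars σ) + #(negVars σ) ≤ D) :
    ∃ g ∈ degLE (univ \ (O ∪ Z)) D, ∀ Y ⊆ univ \ (O ∪ Z),
      (∏ z, point (O ∪ Y) z ^ σ z) = g Y := by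
  by_cases h1 : Disjoint (posVars σ) Z
  swap
  · refine ⟨0, Submodule.zero_mem _, fun Y hY => ?_⟩
    obtain ⟨i, hi, hiZ⟩ := not_disjoint_iff.1 h1
    rw [prod_point_pow, ind, if_neg, zero_mul, Pi.zero_apply]
    intro hs
    rcases mem_union.1 (hs hi) with h' | h'
    · exact disjoint_left.1 hOZ h' hiZ
    · exact (mem_sdiff.1 (hY h')).2 (mem_union_right _ hiZ)
  by_cases h2 : Disjoint (negVars σ) O
  swap
  · refine ⟨0, Submodule.zero_mem _, fun Y hY => ?_⟩
    obtain ⟨i, hi, hiO⟩ := not_disjoint_iff.1 h2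
    rw [prod_point_pow, prod_eq_zero hi, mul_zero, Pi.zero_apply]
    simp [ind, hiO]
  refine ⟨ind (posVars σ \ O) * ∏ i ∈ negVars σ \ Z, (1 - ind {i}), ?_, fun Y hY => ?_⟩
  · refine degLE_mono _ ((Nat.add_le_add (card_le_card sdiff_subset)
      (card_le_card sdiff_subset)).trans (h h1 h2))
      (mul_prod_one_sub_mem_degLE (ind_mem_degLE ?_ le_rfl) _ ?_)
    · intro i hi
      have := disjoint_left.1 h1 (mem_sdiff.1 hi).1
      simp_all
    · intro i hi
      have := disjoint_left.1 h2 (mem_sdiff.1 hi).1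
      simp_all
  · rw [prod_point_pow, Pi.mul_apply, Finset.prod_apply]
    congr 1
    · have : posVars σ ⊆ O ∪ Y ↔ posVars σ \ O ⊆ Y := sdiff_le_iff.symm
      simp only [ind, this]
    · symm
      rw [prod_subset_one_on_sdiff (sdiff_subset (s := negVars σ) (t := Z))]
      · intro i hi
        have hi' : i ∈ Z := by
          have := mem_sdiff.1 hi
          by_contra hc
          exact this.2 (mem_sdiff.2 ⟨this.1, hc⟩)
        have hY' : i ∉ Y := fun hiY => (mem_sdiff.1 (hY hiY)).2 (mem_union_right _ hi')
        have hO' : i ∉ O := fun hiO => disjoint_left.1 hOZ hiO hi'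
        simp [ind, hY', hO']
      · intro i hi
        have hO' : i ∉ O := disjoint_left.1 h2 (mem_sdiff.1 hi).1
        simp [ind, hO']

lemma exists_restrict {n : ℕ} {O Z : Finset (Fin n)} (hOZ : Disjoint O Z) (f : TwinPoly n) {D : ℕ}
    (h : ∀ σ ∈ f.support, Disjoint (posVars σ) Z → Disjoint (negVars σ) O →
      #(posVars σ) + #(negVars σ) ≤ D) :
    ∃ g ∈ degLE (univ \ (O ∪ Z)) D, ∀ Y ⊆ univ \ (O ∪ Z),
      MvPolynomial.eval (point (O ∪ Y)) f = g Y := by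
  have key := fun σ hσ => exists_restrict_monomial hOZ σ (h σ hσ)
  choose! g hg hgY using key
  refine ⟨∑ σ ∈ f.support, f.coeff σ • g σ,
    Submodule.sum_mem _ fun σ hσ => Submodule.smul_mem _ _ (hg σ hσ), fun Y hY => ?_⟩
  rw [MvPolynomial.eval_eq', Finset.sum_apply]
  exact sum_congr rfl fun σ hσ => by rw [hgY σ hσ Y hY, Pi.smul_apply, smul_eq_mul]

/-! ### Size of refutations -/

lemma eval_sumSq {n : ℕ} (x : Fin n ⊕ Fin n → ℝ) (rs : List (TwinPoly n)) :
    MvPolynomial.eval x (sumSq rs) = (rs.map fun r => MvPolynomial.eval x r ^ 2).sum := by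
  simp [sumSq, map_list_sum, List.map_map, Function.comp_def]

/-- The identity of a refutation, evaluated at a point of the Boolean cube. -/
lemma KnapsackRefutation.eval_point {n k : ℕ} (π : KnapsackRefutation n k) (X : Finset (Fin n)) :
    -1 = (π.r₀.map fun r => MvPolynomial.eval (point X) r ^ 2).sum
      + MvPolynomial.eval (point X) (π.t 0) * (2 * #X - k) := by
  have h := congrArg (MvPolynomial.eval (point X)) π.identity
  have hu : ∀ z, MvPolynomial.eval (point X) (boolAxiom z) = 0 := by
    rintro (i | i) <;> by_cases hi : i ∈ X <;> simp [boolAxiom, point, hi]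
  have hv : ∀ i, MvPolynomial.eval (point X) (twinAxiom i) = 0 := by
    intro i
    by_cases hi : i ∈ X <;> simp [twinAxiom, point, hi]
  have hk : MvPolynomial.eval (point X) (knapsackPoly n k) = 2 * #X - k := by
    simp [knapsackPoly, point, ← mul_sum]
  simpa [hu, hv, hk, eval_sumSq] using h

lemma KnapsackRefutation.monomialSize_eq {n k : ℕ} (π : KnapsackRefutation n k) :
    SOSProof.monomialSize π = (π.r₀.map size).sum + size (π.t 0) := by
  simp [SOSProof.monomialSize]

lemma exists_support_cover {n : ℕ} (rs : List (TwinPoly n)) :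
    ∃ M : Finset (Fin n ⊕ Fin n →₀ ℕ), (∀ r ∈ rs, r.support ⊆ M) ∧ #M ≤ (rs.map size).sum := by
  classical
  induction rs with
  | nil => exact ⟨∅, by simp⟩
  | cons r rs ih =>
    obtain ⟨M, hM, hc⟩ := ih
    refine ⟨r.support ∪ M, ?_, ?_⟩
    · intro r' hr'
      rcases List.mem_cons.1 hr' with rfl | h
      · exact subset_union_left
      · exact (hM r' h).trans subset_union_right
    · rw [List.map_cons, List.sum_cons]
      exact (card_union_le _ _).trans (Nat.add_le_add_left hc _)

/-- This serves small `k`. With at most one term in all, either `t = 0`, leaving `-1` a sum of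
squares, or `-1 = t * (2 * #X - k)` with `t` a single term. Then `t` takes the same nonzero value at
`∅` and `univ`, although `2 * #X - k` differs. -/
lemma KnapsackRefutation.two_le_monomialSize {n k : ℕ} (hn : 0 < n) (π : KnapsackRefutation n k) :
    2 ≤ SOSProof.monomialSize π := by
  by_contra! hlt
  rw [monomialSize_eq] at hlt
  have h0 := π.eval_point ∅
  have h1 := π.eval_point univ
  have hnn : ∀ X : Finset (Fin n),
      0 ≤ (π.r₀.map fun r => MvPolynomial.eval (point X) r ^ 2).sum := fun X => by
    refine List.sum_nonneg fun y hy => ?_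
    obtain ⟨r, -, rfl⟩ := List.mem_map.1 hy
    positivity
  by_cases ht : size (π.t 0) = 0
  · have ht : π.t 0 = 0 := by simpa [size] using ht
    rw [ht, map_zero, zero_mul] at h0
    linarith [hnn ∅]
  have hr : ∀ r ∈ π.r₀, r = 0 := by
    intro r hr
    have := List.single_le_sum (l := π.r₀.map size) (by simp) _ (List.mem_map_of_mem hr)
    have : size r = 0 := by omega
    simpa [size] using this
  have hz : ∀ X : Finset (Fin n),
      (π.r₀.map fun r => MvPolynomial.eval (point X) r ^ 2).sum = 0 := fun X =>
    List.sum_eq_zero fun y hy => by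
      obtain ⟨r, hr', rfl⟩ := List.mem_map.1 hy
      simp [hr r hr']
  obtain ⟨σ, hσ⟩ := card_eq_one.1 (show #(π.t 0).support = 1 by unfold size at *; omega)
  rw [hz, MvPolynomial.eval_eq', hσ, sum_singleton, prod_point_pow, zero_add] at h0 h1
  have hn' : (0 : ℝ) < n := by exact_mod_cast hn
  have e0 : ∀ X : Finset (Fin n),
      ind (posVars σ) X * ∏ i ∈ negVars σ, (1 - ind {i} X) ≠ 0 →
      ind (posVars σ) X * ∏ i ∈ negVars σ, (1 - ind {i} X) = 1 := by
    intro X hX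
    have h1 : ind (posVars σ) X = 1 := by
      have := left_ne_zero_of_mul hX
      unfold ind at this ⊢
      simp_all
    have h2 : ∏ i ∈ negVars σ, (1 - ind {i} X) = 1 := by
      refine prod_eq_one fun i hi => ?_
      have := prod_ne_zero_iff.1 (right_ne_zero_of_mul hX) i hi
      unfold ind at this ⊢
      split_ifs at this ⊢ <;> simp_all
    rw [h1, h2, one_mul]
  rw [e0 _ (fun h => by rw [h] at h0; norm_num at h0)] at h0
  rw [e0 _ (fun h => by rw [h] at h1; norm_num at h1)] at h1
  simp only [card_empty, card_univ, Fintype.card_fin, Nat.cast_zero] at h0 h1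
  have hc : MvPolynomial.coeff σ (π.t 0) * n = 0 := by linarith
  rcases mul_eq_zero.1 hc with hc | hc
  · rw [hc] at h0
    norm_num at h0
  · linarith

/-- The size lower bound, in combinatorial form. -/
lemma KnapsackRefutation.pow_le_monomialSize_mul {n k m : ℕ} (hk : k ≤ n) (hm : 32 * m ≤ k)
    (hm0 : 0 < m) (π : KnapsackRefutation n k) :
    n ^ m ≤ SOSProof.monomialSize π * (n - m) ^ m := by
  by_contra! hlt
  rw [monomialSize_eq] at hlt
  obtain ⟨M₀, hM₀, hc₀⟩ := exists_support_cover π.r₀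
  classical
  set M := M₀ ∪ (π.t 0).support with hMdef
  have hMc : #M ≤ (π.r₀.map size).sum + size (π.t 0) :=
    (card_union_le _ _).trans (Nat.add_le_add_right hc₀ _)
  have hit : ∀ A : (Fin n ⊕ Fin n →₀ ℕ) → Finset (Fin n),
      ∃ Z : Finset (Fin n), #Z ≤ m ∧ ∀ σ ∈ M, Disjoint (A σ) Z → #(A σ) < m := by
    intro A
    obtain ⟨Z, hZ, h⟩ := exists_hitting_set A (d := m) (by simp; omega) {σ ∈ M | m ≤ #(A σ)}
      (by simp) m
    refine ⟨Z, hZ, fun σ hσ hd => ?_⟩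
    by_contra! hcard
    rw [Fintype.card_fin] at h
    have hpos : 1 ≤ #{σ ∈ {σ ∈ M | m ≤ #(A σ)} | Disjoint (A σ) Z} :=
      card_pos.2 ⟨σ, by simp [hσ, hcard, hd]⟩
    have : n ^ m ≤ ((π.r₀.map size).sum + size (π.t 0)) * (n - m) ^ m :=
      calc n ^ m ≤ _ * n ^ m := Nat.le_mul_of_pos_left _ hpos
        _ ≤ _ := h
        _ ≤ _ := Nat.mul_le_mul_right _ ((card_le_card (filter_subset _ _)).trans hMc)
    omega
  obtain ⟨Z, hZ, hZM⟩ := hit posVars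
  -- Indices in `Z` are already set to `0`, so only those outside can be set to `1`. Ignoring `Z`
  -- costs at most `m` further variables, whence `3 * m`.
  obtain ⟨O', hO', hOM⟩ := hit fun σ => negVars σ \ Z
  set O := O' \ Z with hOdef
  have hOZ : Disjoint O Z := sdiff_disjoint
  have hO : #O ≤ m := (card_le_card sdiff_subset).trans hO'
  have hdeg : ∀ σ ∈ M, Disjoint (posVars σ) Z → Disjoint (negVars σ) O →
      #(posVars σ) + #(negVars σ) ≤ 3 * m := by
    intro σ hσ h1 h2
    have := hZM σ hσ h1
    have := hOM σ hσ (by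
      rw [disjoint_left] at h2 ⊢
      intro i hi hi'
      exact h2 (mem_sdiff.1 hi).1 (mem_sdiff.2 ⟨hi', (mem_sdiff.1 hi).2⟩))
    have := le_card_sdiff Z (negVars σ)
    omega
  have hV : #(univ \ (O ∪ Z)) + (#O + #Z) = n := by
    rw [← card_union_of_disjoint hOZ, card_sdiff_add_card_eq_card (subset_univ _), card_univ,
      Fintype.card_fin]
  have key := fun f (hf : f.support ⊆ M) =>
    exists_restrict hOZ f (D := 3 * m) fun σ hσ => hdeg σ (hf hσ)
  choose! g hg hgY using key
  have hsup : ∀ r ∈ π.r₀, r.support ⊆ M := fun r hr => (hM₀ r hr).trans subset_union_left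
  have ht : (π.t 0).support ⊆ M := subset_union_right
  have hmR : 32 * (m : ℝ) ≤ k := by exact_mod_cast hm
  have hkR : (k : ℝ) ≤ n := by exact_mod_cast hk
  have hOR : (#O : ℝ) ≤ m := by exact_mod_cast hO
  have hZR : (#Z : ℝ) ≤ m := by exact_mod_cast hZ
  have hVR : (#(univ \ (O ∪ Z)) : ℝ) + (#O + #Z) = n := by exact_mod_cast hV
  -- Here `2 * #(O ∪ Y) - k = 2 * (#Y - κ)`, and the factor `2` moves into `t`. The condition `32 *
  -- m ≤ k` amply covers the degree conditions.
  refine no_low_degree_refutation (V := univ \ (O ∪ Z)) (κ := k / 2 - #O) (D := 3 * m)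
    (rs := π.r₀.map g) (t := (2 : ℝ) • g (π.t 0)) ?_ ?_ (by omega) ?_
    (Submodule.smul_mem _ _ (hg _ ht)) ?_
  · push_cast
    linarith
  · push_cast
    linarith
  · intro f hf
    obtain ⟨r, hr, rfl⟩ := List.mem_map.1 hf
    exact hg r (hsup r hr)
  · intro Y hY
    rw [π.eval_point (O ∪ Y), List.map_map]
    have hdis : Disjoint O Y := disjoint_left.2 fun i hi hiY =>
      (mem_sdiff.1 (hY hiY)).2 (mem_union_left _ hi)
    congr 1
    · refine congrArg List.sum (List.map_congr_left fun r hr => ?_)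
      simp [hgY r (hsup r hr) Y hY]
    · rw [hgY _ ht Y hY, card_union_of_disjoint hdis, Pi.smul_apply, smul_eq_mul]
      push_cast
      ring

end SOSKnapsack

theorem mainTheorem7 :
    ∃ ε : ℝ, 0 < ε ∧ ∃ N : ℕ, ∀ n : ℕ, N ≤ n → ∀ k : ℕ, 1 ≤ k → k ≤ n →
      ∀ π : SOSKnapsack.KnapsackRefutation n k,
        (2 : ℝ) ^ (ε * (k : ℝ) ^ 2 / (n : ℝ)) ≤ (π.monomialSize : ℝ) := by
  -- `4096 = 64 ^ 2`, as `k ≤ 64 * m` for `m = k / 32` once `32 ≤ k`. For smaller `k` the exponent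
  -- is at most `1`.
  refine ⟨1 / 4096, by norm_num, 0, fun n _ k hk1 hkn π => ?_⟩
  have hn : (0 : ℝ) < n := by exact_mod_cast hk1.trans hkn
  have hkR : (k : ℝ) ≤ n := by exact_mod_cast hkn
  rcases lt_or_ge k 32 with hk | hk
  · have h2 : (2 : ℝ) ≤ (π.monomialSize : ℝ) := by
      exact_mod_cast SOSKnapsack.KnapsackRefutation.two_le_monomialSize (by omega) π
    refine le_trans ?_ h2
    have hexp : 1 / 4096 * (k : ℝ) ^ 2 / n ≤ 1 := by
      rw [div_le_one hn]
      have : (k : ℝ) < 32 := by exact_mod_cast hk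
      nlinarith [(Nat.cast_nonneg k : (0 : ℝ) ≤ k)]
    calc (2 : ℝ) ^ (1 / 4096 * (k : ℝ) ^ 2 / n) ≤ 2 ^ (1 : ℝ) :=
          Real.rpow_le_rpow_of_exponent_le (by norm_num) hexp
      _ = 2 := Real.rpow_one 2
  · set m := k / 32 with hm
    have hmk : 32 * m ≤ k := Nat.mul_div_le k 32
    have hkm : (k : ℝ) ≤ 64 * m := by exact_mod_cast (by omega : k ≤ 64 * m)
    have hle := SOSKnapsack.KnapsackRefutation.pow_le_monomialSize_mul hkn hmk (by omega) π
    have hmn : m ≤ n := by omega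
    have hle' : (n : ℝ) ^ m ≤ π.monomialSize * ((n : ℝ) - m) ^ m := by
      rw [← Nat.cast_sub hmn]
      exact_mod_cast hle
    have hbase : (n : ℝ) - m ≤ n * Real.exp (-(m / n)) := by
      have := Real.add_one_le_exp (-((m : ℝ) / n))
      calc (n : ℝ) - m = n * (-(m / n) + 1) := by field_simp; ring
        _ ≤ _ := by gcongr
    have hnm : (0 : ℝ) ≤ (n : ℝ) - m := sub_nonneg.2 (by exact_mod_cast hmn)
    have hpow : ((n : ℝ) - m) ^ m ≤ (n : ℝ) ^ m * Real.exp (-((m : ℝ) ^ 2 / n)) := by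
      refine (pow_le_pow_left₀ hnm hbase m).trans_eq ?_
      rw [mul_pow, ← Real.exp_nat_mul]
      congr 2
      ring
    have hone : (n : ℝ) ^ m * 1
        ≤ (n : ℝ) ^ m * (π.monomialSize * Real.exp (-((m : ℝ) ^ 2 / n))) := by
      rw [mul_one, mul_left_comm]
      exact hle'.trans (mul_le_mul_of_nonneg_left hpow (Nat.cast_nonneg _))
    have hone := le_of_mul_le_mul_left hone (pow_pos hn m)
    rw [Real.exp_neg, ← div_eq_mul_inv, one_le_div (Real.exp_pos _)] at hone
    refine le_trans ?_ hone
    rw [Real.rpow_def_of_pos two_pos, Real.exp_le_exp]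
    have hlog : Real.log 2 ≤ 1 := by linarith [Real.log_two_lt_d9]
    have hx : 0 ≤ 1 / 4096 * (k : ℝ) ^ 2 / n := by positivity
    calc Real.log 2 * (1 / 4096 * (k : ℝ) ^ 2 / n) ≤ 1 * (1 / 4096 * (k : ℝ) ^ 2 / n) := by gcongr
      _ = 1 / 4096 * (k : ℝ) ^ 2 / n := one_mul _
      _ ≤ (m : ℝ) ^ 2 / n := by
        gcongr
        nlinarith [(Nat.cast_nonneg k : (0 : ℝ) ≤ k)]
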